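/- Let $D$ be a random variable with values in $\mathbb{Z}_+=\{0,1,2,\dots\}$ and mean $d=\mathbb{E}[D]\in(0,\infty)$, and let $G_D(z)=\mathbb{E}[z^{D}]$ be its generating function. Let $\pi_k$ and $\Pi_k$ ($k\in\mathbb{Z}$) denote the probability mass function and the distribution function of the Poisson distribution with parameter $d$ (both are $0$ for $k<0$), and let $\bar\Pi_k=1-\Pi_k$. Define $f$ on $\mathbb{Z}_+$ by $f(0)=0$ and $$f(s)=\frac{G_D(\bar\Pi_{s-2})-G_D(\bar\Pi_{s-1})}{d\,\pi_{s-1}},\qquad s\ge 1.$$ (a) If $D\equiv d$ is deterministic, with $d$ a positive integer, then $f$ takes values in $[0,1]$ and, for every $s\ge1$, $$f(s)=\frac{\bar\Pi_{s-2}^{\,d}-\bar\Pi_{s-1}^{\,d}}{d\,\pi_{s-1}}.$$ (b) If $D$ has the Poisson distribution with mean $d>0$, then $f$ takes values in $[0,1]$ and, for every $s\ge1$, $$f(s)=\frac{e^{-d\,\Pi_{s-2}}-e^{-d\,\Pi_{s-1}}}{d\,\pi_{s-1}}.$$ -/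

import Mathlib

open MeasureTheory ProbabilityTheory
open scoped NNReal

namespace BipartiteMatching

noncomputable section

/-- The Poisson probability mass function `π_k` with parameter `r`, for `k : ℤ`
(so that `π_k = 0` for negative `k`). -/
def poisPMF (r : ℝ≥0) (k : ℤ) : ℝ := (poissonMeasure r).real {n : ℕ | (n : ℤ) = k}

/-- The Poisson distribution function `Π_k` with parameter `r`, for `k : ℤ`
(so that `Π_k = 0` for negative `k`). -/
def poisCDF (r : ℝ≥0) (k : ℤ) : ℝ := (poissonMeasure r).real {n : ℕ | (n : ℤ) ≤ k}

/-- The complementary Poisson distribution function `1 - Π_k` with parameter `r`. -/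
def poisCCDF (r : ℝ≥0) (k : ℤ) : ℝ := 1 - poisCDF r k

variable {Ω : Type*} [MeasurableSpace Ω]

/-- The mean `E[D]` of the out-degree `D`, as a nonnegative real. -/
def meanDeg (P : Measure Ω) (D : Ω → ℕ) : ℝ≥0 :=
  ⟨∫ ω, (D ω : ℝ) ∂P, integral_nonneg fun ω => Nat.cast_nonneg (D ω)⟩

/-- The generating function `G_D(z) = E[z ^ D]` of the out-degree `D`. -/
def genFun (P : Measure Ω) (D : Ω → ℕ) (z : ℝ) : ℝ := ∫ ω, z ^ D ω ∂P

/-- The function `f` entering the lower bound for the greedy rule: `f 0 = 0` and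
`f s = (G_D(1 - Π_{s-2}) - G_D(1 - Π_{s-1})) / (E[D] π_{s-1})` for `s ≥ 1`, where `π` and `Π` are
the mass function and the distribution function of the Poisson law with parameter `E[D]`. -/
def greedyF (P : Measure Ω) (D : Ω → ℕ) (s : ℕ) : ℝ :=
  if s = 0 then 0
  else
    (genFun P D (poisCCDF (meanDeg P D) ((s : ℤ) - 2))
        - genFun P D (poisCCDF (meanDeg P D) ((s : ℤ) - 1)))
      / ((meanDeg P D : ℝ) * poisPMF (meanDeg P D) ((s : ℤ) - 1))

end

end BipartiteMatching

namespace BipartiteMatching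

/-! The numerator of `f s` is the increment of `G_D` over a subinterval of `[0, 1]` of length
`π_{s-1}` (`poisCCDF_sub_poisCCDF`). Hence `0 ≤ f s ≤ 1` once `G_D` is nondecreasing and
`E[D]`-Lipschitz on `[0, 1]` (`greedyF_mem_Icc`). Both properties hold for `z ^ d` and `exp (d (z -
1))`, the generating functions in the two cases; substituting them gives the formulas. -/

lemma poisCDF_nonneg (r : ℝ≥0) (k : ℤ) : 0 ≤ poisCDF r k := measureReal_nonneg

lemma poisCCDF_nonneg (r : ℝ≥0) (k : ℤ) : 0 ≤ poisCCDF r k :=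
  sub_nonneg.2 measureReal_le_one

lemma poisCCDF_le_one (r : ℝ≥0) (k : ℤ) : poisCCDF r k ≤ 1 :=
  sub_le_self _ (poisCDF_nonneg r k)

lemma poisCDF_add_one (r : ℝ≥0) (k : ℤ) :
    poisCDF r (k + 1) = poisCDF r k + poisPMF r (k + 1) := by
  have h : {n : ℕ | (n : ℤ) ≤ k + 1} = {n : ℕ | (n : ℤ) ≤ k} ∪ {n : ℕ | (n : ℤ) = k + 1} := by
    ext n
    simp only [Set.mem_ofPred_eq, Set.mem_union]
    omega
  rw [poisCDF, h, measureReal_union _ .of_discrete]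
  · rfl
  · refine Set.disjoint_left.2 fun n h₁ h₂ => ?_
    simp only [Set.mem_ofPred_eq] at h₁ h₂
    omega

lemma poisCCDF_sub_poisCCDF (r : ℝ≥0) (k : ℤ) :
    poisCCDF r (k - 2) - poisCCDF r (k - 1) = poisPMF r (k - 1) := by
  have h := poisCDF_add_one r (k - 2)
  rw [show k - 2 + 1 = k - 1 by ring] at h
  rw [poisCCDF, poisCCDF, h]
  ring

lemma poisPMF_pos {r : ℝ≥0} (hr : 0 < r) {k : ℤ} (hk : 0 ≤ k) : 0 < poisPMF r k := by
  lift k to ℕ using hk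
  have h : {n : ℕ | (n : ℤ) = k} = {k} := by ext n; simp
  rw [poisPMF, h]
  exact poissonMeasure_real_singleton_pos k hr

/-- Discrete form of the derivative bound `n z ^ (n - 1) ≤ n` on `[0, 1]`. -/
lemma pow_sub_pow_le_mul_sub {x y : ℝ} (hy : 0 ≤ y) (hyx : y ≤ x) (hx : x ≤ 1) (n : ℕ) :
    x ^ n - y ^ n ≤ n * (x - y) := by
  induction n with
  | zero => simp
  | succ n ih =>
    have h₁ : x * (x ^ n - y ^ n) ≤ 1 * (x ^ n - y ^ n) :=
      mul_le_mul_of_nonneg_right hx (sub_nonneg.2 (pow_le_pow_left₀ hy hyx n))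
    have h₂ : y ^ n * (x - y) ≤ 1 * (x - y) :=
      mul_le_mul_of_nonneg_right (pow_le_one₀ hy (hyx.trans hx)) (sub_nonneg.2 hyx)
    calc x ^ (n + 1) - y ^ (n + 1) = x * (x ^ n - y ^ n) + y ^ n * (x - y) := by ring
      _ ≤ n * (x - y) + (x - y) := by linarith
      _ = (n + 1 : ℕ) * (x - y) := by push_cast; ring

/-- Factor out `exp x ≤ 1` and apply `1 + t ≤ exp t` at `t = y - x`. -/
lemma exp_sub_exp_le {x y : ℝ} (hx : x ≤ 0) (hyx : y ≤ x) :
    Real.exp x - Real.exp y ≤ x - y := by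
  have h₁ : 1 - Real.exp (y - x) ≤ x - y := by linarith [Real.add_one_le_exp (y - x)]
  have h₂ : 0 ≤ 1 - Real.exp (y - x) :=
    sub_nonneg.2 (Real.exp_le_one_iff.2 (sub_nonpos.2 hyx))
  calc Real.exp x - Real.exp y = Real.exp x * (1 - Real.exp (y - x)) := by
        rw [mul_sub, ← Real.exp_add]; ring_nf
    _ ≤ 1 * (1 - Real.exp (y - x)) :=
        mul_le_mul_of_nonneg_right (Real.exp_le_one_iff.2 hx) h₂
    _ ≤ x - y := by linarith

lemma integral_natCast_poissonMeasure (r : ℝ≥0) :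
    ∫ n : ℕ, (n : ℝ) ∂(poissonMeasure r) = r := by
  have h : HasSum (fun n : ℕ => (Real.exp (-r) * r ^ n / n.factorial) • (n : ℝ)) r := by
    -- The term `n = 0` vanishes, and `(n + 1) π_{n+1} = r π_n`, so the sum is `r` times the total
    -- mass.
    rw [← hasSum_nat_add_iff' 1]
    convert! (hasSum_one_poissonMeasure r).mul_left (r : ℝ) using 1
    · ext n
      rw [smul_eq_mul, Nat.factorial_succ]
      push_cast
      field_simp
      ring
    · simp
  rw [integral_poissonMeasure, h.tsum_eq]

lemma integral_pow_poissonMeasure (r : ℝ≥0) (z : ℝ) :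
    ∫ n : ℕ, z ^ n ∂(poissonMeasure r) = Real.exp (r * (z - 1)) := by
  have h : HasSum (fun n : ℕ => (Real.exp (-r) * r ^ n / n.factorial) • z ^ n)
      (Real.exp (r * (z - 1))) := by
    convert! (NormedSpace.expSeries_div_hasSum_exp ((r : ℝ) * z)).mul_left (Real.exp (-r)) using 1
    · ext n
      rw [smul_eq_mul, mul_pow]
      ring
    · rw [← Real.exp_eq_exp_ℝ, ← Real.exp_add]
      ring_nf
  rw [integral_poissonMeasure, h.tsum_eq]

variable {Ω : Type*} [MeasurableSpace Ω] {P : Measure Ω} {D : Ω → ℕ}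

lemma greedyF_zero : greedyF P D 0 = 0 := if_pos rfl

/-- If the generating function of `D` is nondecreasing and `E[D]`-Lipschitz on `[0, 1]`, then `f`
takes values in `[0, 1]`. -/
lemma greedyF_mem_Icc (hpos : 0 < meanDeg P D)
    (hmono : ∀ x y : ℝ, 0 ≤ y → y ≤ x → x ≤ 1 → genFun P D y ≤ genFun P D x)
    (hlip : ∀ x y : ℝ, 0 ≤ y → y ≤ x → x ≤ 1 →
      genFun P D x - genFun P D y ≤ meanDeg P D * (x - y)) (s : ℕ) :
    greedyF P D s ∈ Set.Icc (0 : ℝ) 1 := by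
  rcases Nat.eq_zero_or_pos s with rfl | hs
  · simp [greedyF_zero]
  have hπ : 0 < poisPMF (meanDeg P D) ((s : ℤ) - 1) := poisPMF_pos hpos (by omega)
  have hden : 0 < (meanDeg P D : ℝ) * poisPMF (meanDeg P D) ((s : ℤ) - 1) :=
    mul_pos (NNReal.coe_pos.2 hpos) hπ
  have hdiff := poisCCDF_sub_poisCCDF (meanDeg P D) s
  have hle : poisCCDF (meanDeg P D) ((s : ℤ) - 1) ≤ poisCCDF (meanDeg P D) ((s : ℤ) - 2) := by
    linarith
  rw [greedyF, if_neg hs.ne']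
  refine ⟨div_nonneg (sub_nonneg.2 ?_) hden.le, (div_le_one hden).2 ?_⟩
  · exact hmono _ _ (poisCCDF_nonneg _ _) hle (poisCCDF_le_one _ _)
  -- Reading `π_{s-1}` as the length of the interval turns the upper bound into the Lipschitz
  -- estimate.
  · rw [← hdiff]
    exact hlip _ _ (poisCCDF_nonneg _ _) hle (poisCCDF_le_one _ _)

lemma meanDeg_of_ae_eq [IsProbabilityMeasure P] {d : ℕ} (h : ∀ᵐ ω ∂P, D ω = d) :
    meanDeg P D = d := by
  apply NNReal.coe_injective
  change ∫ ω, (D ω : ℝ) ∂P = _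
  rw [integral_congr_ae (g := fun _ => (d : ℝ)) (h.mono fun ω hω => by simp [hω])]
  simp

lemma genFun_of_ae_eq [IsProbabilityMeasure P] {d : ℕ} (h : ∀ᵐ ω ∂P, D ω = d) (z : ℝ) :
    genFun P D z = z ^ d := by
  rw [genFun, integral_congr_ae (g := fun _ => z ^ d) (h.mono fun ω hω => by simp [hω])]
  simp

lemma meanDeg_of_hasLaw_poissonMeasure {d : ℝ≥0} (h : HasLaw D (poissonMeasure d) P) :
    meanDeg P D = d := by
  apply NNReal.coe_injective
  exact (h.integral_comp (f := fun n : ℕ => (n : ℝ)) .of_discrete).trans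
    (integral_natCast_poissonMeasure d)

lemma genFun_of_hasLaw_poissonMeasure {d : ℝ≥0} (h : HasLaw D (poissonMeasure d) P) (z : ℝ) :
    genFun P D z = Real.exp (d * (z - 1)) :=
  (h.integral_comp (f := fun n : ℕ => z ^ n) .of_discrete).trans (integral_pow_poissonMeasure d z)

end BipartiteMatching

theorem mainTheorem5 {Ω : Type*} [MeasurableSpace Ω] (P : Measure Ω) [IsProbabilityMeasure P]
    (D : Ω → ℕ) (hD : Measurable D) :
    -- deterministic out-degree `D ≡ d`
    (∀ d : ℕ, 0 < d → (∀ᵐ ω ∂P, D ω = d) →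
      (∀ s : ℕ, BipartiteMatching.greedyF P D s ∈ Set.Icc (0 : ℝ) 1) ∧
      BipartiteMatching.greedyF P D 0 = 0 ∧
      ∀ s : ℕ, 1 ≤ s →
        BipartiteMatching.greedyF P D s =
          (BipartiteMatching.poisCCDF d ((s : ℤ) - 2) ^ d
              - BipartiteMatching.poisCCDF d ((s : ℤ) - 1) ^ d)
            / ((d : ℝ) * BipartiteMatching.poisPMF d ((s : ℤ) - 1))) ∧
    -- Poisson out-degree with mean `d`
    (∀ d : ℝ≥0, 0 < d → HasLaw D (poissonMeasure d) P →
      (∀ s : ℕ, BipartiteMatching.greedyF P D s ∈ Set.Icc (0 : ℝ) 1) ∧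
      BipartiteMatching.greedyF P D 0 = 0 ∧
      ∀ s : ℕ, 1 ≤ s →
        BipartiteMatching.greedyF P D s =
          (Real.exp (-((d : ℝ) * BipartiteMatching.poisCDF d ((s : ℤ) - 2)))
              - Real.exp (-((d : ℝ) * BipartiteMatching.poisCDF d ((s : ℤ) - 1))))
            / ((d : ℝ) * BipartiteMatching.poisPMF d ((s : ℤ) - 1))) := by
  open BipartiteMatching in
  refine ⟨fun d hd h => ?_, fun d hd h => ?_⟩
  · have hm := meanDeg_of_ae_eq h
    refine ⟨greedyF_mem_Icc ?_ ?_ ?_, greedyF_zero, fun s hs => ?_⟩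
    · rw [hm]
      exact_mod_cast hd
    · intro x y hy hyx _
      rw [genFun_of_ae_eq h, genFun_of_ae_eq h]
      exact pow_le_pow_left₀ hy hyx d
    · intro x y hy hyx hx
      rw [genFun_of_ae_eq h, genFun_of_ae_eq h, hm]
      exact pow_sub_pow_le_mul_sub hy hyx hx d
    · rw [greedyF, if_neg (by omega), genFun_of_ae_eq h, genFun_of_ae_eq h, hm, NNReal.coe_natCast]
  · have hm := meanDeg_of_hasLaw_poissonMeasure h
    refine ⟨greedyF_mem_Icc ?_ ?_ ?_, greedyF_zero, fun s hs => ?_⟩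
    · rwa [hm]
    · intro x y _ hyx _
      rw [genFun_of_hasLaw_poissonMeasure h, genFun_of_hasLaw_poissonMeasure h]
      gcongr
    · intro x y _ hyx hx
      rw [genFun_of_hasLaw_poissonMeasure h, genFun_of_hasLaw_poissonMeasure h, hm]
      -- The exponents `d (z - 1)` are nonpositive for `z ≤ 1` and differ by `d (x - y)`.
      refine (exp_sub_exp_le ?_ ?_).trans_eq (by ring)
      · exact mul_nonpos_of_nonneg_of_nonpos d.coe_nonneg (by linarith)
      · gcongr
    · have hexp (k : ℤ) : (d : ℝ) * (poisCCDF d k - 1) = -(d * poisCDF d k) := by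
        rw [poisCCDF]
        ring
      rw [greedyF, if_neg (by omega), genFun_of_hasLaw_poissonMeasure h,
        genFun_of_hasLaw_poissonMeasure h, hm, hexp, hexp]
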